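/- For a nonempty index $\mathbf k=(k_1,\ldots,k_r)\in\mathbb Z_{\ge1}^r$ put $\mathbf k_+=(k_1,\ldots,k_{r-1},k_r+1)$, let $$\mathrm{Li}_{\mathbf k}(z)=\sum_{1\le m_1<\cdots<m_r}\frac{z^{m_r}}{m_1^{k_1}\cdots m_r^{k_r}},\qquad \zeta(\mathbf k)=\mathrm{Li}_{\mathbf k}(1)\ \text{ if $\mathbf k$ is admissible, i.e. } k_r\ge2,$$ $$\xi(\mathbf k;s)=\frac1{\Gamma(s)}\int_0^\infty t^{s-1}\,\frac{\mathrm{Li}_{\mathbf k}(1-e^{-t})}{e^t-1}\,dt\qquad(\mathrm{Re}(s)>0).$$ The empty index is also regarded as admissible, with $\zeta(\emptyset)=1$. Let $\mathfrak H=\mathbb Q\langle x,y\rangle$ with the shuffle product ш, that is, the $\mathbb Q$-bilinear product with $1$ш$w=w$ш$1=w$ and $au$ш$bv=a(u$ш$bv)+b(au$ш$v)$ for words $w,u,v$ and letters $a,b$; let $\mathfrak H^1=\mathbb Q+\mathfrak H y$, and attach to an index the word $w(\mathbf k)=x^{k_r-1}y\,x^{k_{r-1}-1}y\cdots x^{k_1-1}y\in\mathfrak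 H^1$ (and $w(\emptyset)=1$). Then there is a unique homomorphism of $\mathbb Q$-algebras $Z$ from $(\mathfrak H^1,\text{ш})$ to $\mathbb R[T]$ with $Z(w(\mathbf k))=\zeta(\mathbf k)$ for all admissible $\mathbf k$ and $Z(y)=T$. For any index $\mathbf k$, let $\zeta^{ш}(\mathbf k)$ be the constant term of the polynomial $Z(w(\mathbf k))$ (the shuffle-regularized multiple zeta value of Ihara–Kaneko–Zagier). For every nonempty index $\mathbf k$ and every integer $m\ge1$, the integral defining $\xi(\mathbf k;m)$ converges absolutely and $$\xi(\mathbf k;m)=(-1)^{m-1}\,\zeta^{ш}(\mathbf k_+,\underbrace{1,\ldots,1}_{m-1}).$$ -/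

import Mathlib

open scoped Polynomial

noncomputable section

/-- An index `(k₁, …, k_r)` of positive integers, of depth `r = k.length`. -/
abbrev MZIndex : Type := List ℕ+

namespace MZIndex

/-- An index is admissible when its last entry is at least two. The empty index counts as
admissible (it corresponds to the unit word). -/
def Admissible (k : MZIndex) : Prop := ∀ a ∈ k.getLast?, 2 ≤ a

/-- `k₊ = (k₁, …, k_{r-1}, k_r + 1)`. -/
def plus : MZIndex → MZIndex
  | [] => []
  | [a] => [a + 1]
  | a :: b :: l => a :: plus (b :: l)

/-- The truncated multiple harmonic sum, for an index listed from the last entry to the first: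
`truncSum [k_r, …, k₁] n = ∑_{1 ≤ m₁ < ⋯ < m_r < n} 1 / (m₁ ^ k₁ ⋯ m_r ^ k_r)`, where the
outermost summation is over `m_r` and the empty index gives `1`. -/
def truncSum : List ℕ+ → ℕ → ℝ
  | [], _ => 1
  | a :: l, n => ∑ m ∈ Finset.Ico 1 n, truncSum l m / (m : ℝ) ^ (a : ℕ)

/-- The multiple polylogarithm
`Li_k(z) = ∑_{1 ≤ m₁ < ⋯ < m_r} z ^ m_r / (m₁ ^ k₁ ⋯ m_r ^ k_r)`,
where the outer summation is over `m_r = n + 1`. It is used for `0 ≤ z < 1`, and for `z = 1`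
when `k` is admissible; in these cases the series of nonnegative terms converges. -/
def polylog (k : MZIndex) (z : ℝ) : ℝ :=
  match k.reverse with
  | [] => 1
  | a :: l => ∑' n : ℕ, z ^ (n + 1) * truncSum l (n + 1) / ((n + 1 : ℕ) : ℝ) ^ (a : ℕ)

/-- The multiple zeta value
`ζ(k) = ∑_{1 ≤ m₁ < ⋯ < m_r} 1 / (m₁ ^ k₁ ⋯ m_r ^ k_r) = Li_k(1)`, for admissible `k`. -/
def mzv (k : MZIndex) : ℝ := polylog k 1

/-- The integrand `t ^ (s - 1) * Li_k(1 - e^{-t}) / (e ^ t - 1)`, for `t > 0`. -/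
def xiIntegrand (k : MZIndex) (s : ℂ) (t : ℝ) : ℂ :=
  (t : ℂ) ^ (s - 1) * ((polylog k (1 - Real.exp (-t)) / (Real.exp t - 1) : ℝ) : ℂ)

/-- The Arakawa–Kaneko zeta function `ξ(k; s)`, given by its defining integral (for `Re s > 0`). -/
def xi (k : MZIndex) (s : ℂ) : ℂ :=
  1 / Complex.Gamma s * ∫ t in Set.Ioi (0 : ℝ), xiIntegrand k s t

end MZIndex

/-! ### The shuffle algebra on two letters -/

namespace MZShuffle

/-- The two letters `x` and `y`. -/
inductive Letter
  | x
  | y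

/-- The underlying `ℚ`-vector space of `𝔥 = ℚ⟨x, y⟩`, with basis the words in `x` and `y`. -/
abbrev H : Type := List Letter →₀ ℚ

/-- The shuffle product of two words:
`1 ш v = v`, `u ш 1 = u`, `au ш bv = a (u ш bv) + b (au ш v)`. -/
def shuffleWord : List Letter → List Letter → H
  | [], v => Finsupp.single v 1
  | a :: u, [] => Finsupp.single (a :: u) 1
  | a :: u, b :: v =>
      Finsupp.mapDomain (List.cons a) (shuffleWord u (b :: v)) +
        Finsupp.mapDomain (List.cons b) (shuffleWord (a :: u) v)
termination_by u v => u.length + v.length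

/-- The shuffle product on `𝔥`, extended bilinearly from words. -/
def shuffle : H →ₗ[ℚ] H →ₗ[ℚ] H :=
  Finsupp.linearCombination ℚ fun u => Finsupp.linearCombination ℚ (shuffleWord u)

/-- The words that are empty or end with the letter `y`. -/
def wordsH1 : Set (List Letter) := {w | ∀ a ∈ w.getLast?, a = Letter.y}

/-- The subspace `𝔥¹ = ℚ + 𝔥 y`. -/
def H1 : Submodule ℚ H := Finsupp.supported ℚ ℚ wordsH1

theorem mapDomain_cons_mem (a : Letter) (f : H)
    (hf : f ∈ Finsupp.supported ℚ ℚ (wordsH1 ∩ {w | w ≠ []})) :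
    Finsupp.mapDomain (List.cons a) f ∈
      Finsupp.supported ℚ ℚ (wordsH1 ∩ {w | w ≠ []}) := by
  classical
  rw [Finsupp.mem_supported] at hf ⊢
  intro w hw
  have h := Finsupp.mapDomain_support hw
  rw [Finset.mem_image] at h
  obtain ⟨v, hv, rfl⟩ := h
  obtain ⟨h1, h2⟩ := hf hv
  refine ⟨?_, by simp⟩
  cases v with
  | nil => exact absurd rfl h2
  | cons b v => simpa [wordsH1, List.getLast?_cons_cons] using h1

theorem shuffleWord_mem_aux : ∀ u v : List Letter, u ∈ wordsH1 → v ∈ wordsH1 →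
    (u ≠ [] ∨ v ≠ []) →
    shuffleWord u v ∈ Finsupp.supported ℚ ℚ (wordsH1 ∩ {w | w ≠ []})
  | [], v, _, hv, h => by
      rw [shuffleWord]
      exact Finsupp.single_mem_supported ℚ 1 ⟨hv, by simpa using h⟩
  | a :: u, [], hu, _, _ => by
      rw [shuffleWord]
      exact Finsupp.single_mem_supported ℚ 1 ⟨hu, by simp⟩
  | a :: u, b :: v, hu, hv, _ => by
      have tail : ∀ (c : Letter) (w : List Letter), c :: w ∈ wordsH1 → w ∈ wordsH1 := by
        intro c w hw
        cases w with
        | nil => simp [wordsH1]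
        | cons d w => simpa [wordsH1, List.getLast?_cons_cons] using hw
      rw [shuffleWord]
      exact add_mem
        (mapDomain_cons_mem a _
          (shuffleWord_mem_aux u (b :: v) (tail a u hu) hv (Or.inr (by simp))))
        (mapDomain_cons_mem b _
          (shuffleWord_mem_aux (a :: u) v hu (tail b v hv) (Or.inl (by simp))))
termination_by u v => u.length + v.length

theorem shuffleWord_mem (u v : List Letter) (hu : u ∈ wordsH1) (hv : v ∈ wordsH1) :
    shuffleWord u v ∈ H1 := by
  by_cases h : u ≠ [] ∨ v ≠ []
  · exact Finsupp.supported_mono Set.inter_subset_left (shuffleWord_mem_aux u v hu hv h)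
  · push Not at h
    obtain ⟨rfl, rfl⟩ := h
    rw [shuffleWord]
    exact Finsupp.single_mem_supported ℚ 1 hu

/-- `𝔥¹` is closed under the shuffle product. -/
theorem shuffle_mem (f g : H) (hf : f ∈ H1) (hg : g ∈ H1) : shuffle f g ∈ H1 := by
  rw [H1, Finsupp.mem_supported] at hf hg
  simp only [shuffle, Finsupp.linearCombination_apply, Finsupp.sum, LinearMap.sum_apply,
    LinearMap.smul_apply]
  exact Submodule.sum_mem _ fun u hu => Submodule.smul_mem _ _ <|
    Submodule.sum_mem _ fun v hv => Submodule.smul_mem _ _ <|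
      shuffleWord_mem u v (hf hu) (hg hv)

/-- The shuffle product on `𝔥¹`. -/
def shuffleH1 (f g : H1) : H1 := ⟨shuffle f.1 g.1, shuffle_mem f.1 g.1 f.2 g.2⟩

/-- The word of an index. With `z_a = x^{a-1} y`, the index `(k₁, …, k_r)` gives
`z_{k_r} ⋯ z_{k₁}`; the order is reversed because the summation variables increase,
`m₁ < ⋯ < m_r`. -/
def indexWord (k : MZIndex) : List Letter :=
  k.reverse.flatMap fun a => List.replicate ((a : ℕ) - 1) Letter.x ++ [Letter.y]

theorem indexWord_mem (k : MZIndex) : indexWord k ∈ wordsH1 := by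
  cases k with
  | nil => simp [indexWord, wordsH1]
  | cons a l =>
    simp [indexWord, wordsH1, List.flatMap_append, ← List.append_assoc]

/-- The word of an index, as an element of `𝔥¹`. -/
def ofIndex (k : MZIndex) : H1 :=
  ⟨Finsupp.single (indexWord k) 1, Finsupp.single_mem_supported ℚ 1 (indexWord_mem k)⟩

/-- `Z : 𝔥¹ → ℝ[T]` is the shuffle regularization map: it is a homomorphism of `ℚ`-algebras for
the shuffle product, it sends the word of each admissible index to its multiple zeta value, and
it sends `y` to `T`. -/
structure IsRegularization (Z : H1 →ₗ[ℚ] ℝ[X]) : Prop where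
  map_one : Z (ofIndex []) = 1
  map_shuffle : ∀ f g : H1, Z (shuffleH1 f g) = Z f * Z g
  map_admissible : ∀ k : MZIndex, k.Admissible → Z (ofIndex k) = Polynomial.C k.mzv
  map_y : Z (ofIndex [1]) = Polynomial.X

/-- The shuffle regularization map `𝔥¹ → ℝ[T]`: the (unique) linear map satisfying
`IsRegularization`. -/
def regularization : H1 →ₗ[ℚ] ℝ[X] := Classical.epsilon IsRegularization

/-- The shuffle regularized polynomial of an index. -/
def regPolynomial (k : MZIndex) : ℝ[X] := regularization (ofIndex k)

/-- The shuffle regularized multiple zeta value: the constant term of the shuffle regularized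
polynomial. -/
def regMZV (k : MZIndex) : ℝ := (regPolynomial k).coeff 0

end MZShuffle

end

noncomputable section

namespace MZShuffle

open PowerSeries Finset Filter Topology MeasureTheory

/-! ### Iterated integrals as formal power series -/

/-! Everything is read off from the iterated integral of a word, kept as a power series
(`wordSeries`) and evaluated at `z = 1 - e^{-t}`. Integration by parts is the shuffle recursion, so
`series` turns shuffle products on `𝔥¹` into products (`series_shuffle`).

As `t → ∞` each such series equals a polynomial in `t = -log (1 - z)` up to an error that beats
every polynomial (`HasExpansion`). Such expansions are unique and multiplicative, so `w ↦ P_w(T)` is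
a shuffle homomorphism. The word `y` gives `T`, and a word starting with `x` gives its value at `1`,
because its coefficients are `O(n^{-3/2})` (`hasExpansion_letterIntegral_x`). This proves existence;
uniqueness follows by shuffling with `y`, which reduces each word of `𝔥¹` to powers of `y` and
admissible words.

The word of `(k₊, 1, …, 1)` is `yⁿ x w(k)`. With `L_j = (-log (1 - z))^j / j!`, repeated integration
by parts gives `∑_j (-1)^j L_{n-j} ∫ L_j Li_k dz/z` (`wordSeries_replicate_append`). Only `j = n`
contributes to the constant term, which is therefore `(-1)ⁿ ∫₀¹ L_n Li_k dz/z`. Under `z = 1 -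
e^{-t}` one has `L_n = tⁿ/n!` and `dz/z = dt/(e^t - 1)`, so this integral is `ξ(k; n + 1)`. -/

/-- Formal integration from `0` against `dz / z` (letter `x`) or `dz / (1 - z)` (letter `y`);
for the letter `x` the constant term of the integrand is ignored. -/
def letterIntegral : Letter → ℝ⟦X⟧ →ₗ[ℝ] ℝ⟦X⟧
  | .x =>
    { toFun := fun f => PowerSeries.mk fun n => coeff n f / n
      map_add' := fun f g => by ext n; simp [add_div]
      map_smul' := fun c f => by ext n; simp [mul_div_assoc] }
  | .y =>
    { toFun := fun f => PowerSeries.mk fun n => (∑ m ∈ range n, coeff m f) / n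
      map_add' := fun f g => by ext n; simp [sum_add_distrib, add_div]
      map_smul' := fun c f => by ext n; simp [← mul_sum, mul_div_assoc] }

theorem coeff_letterIntegral_x (f : ℝ⟦X⟧) (n : ℕ) :
    coeff n (letterIntegral .x f) = coeff n f / n := by
  simp [letterIntegral]

theorem coeff_letterIntegral_y (f : ℝ⟦X⟧) (n : ℕ) :
    coeff n (letterIntegral .y f) = (∑ m ∈ range n, coeff m f) / n := by
  simp [letterIntegral]

@[simp]
theorem constantCoeff_letterIntegral (a : Letter) (f : ℝ⟦X⟧) :
    constantCoeff (letterIntegral a f) = 0 := by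
  rw [← coeff_zero_eq_constantCoeff_apply]
  cases a <;> simp [letterIntegral]

/-- The reciprocal of the density of the differential form of a letter. -/
def letterDenom : Letter → ℝ⟦X⟧
  | .x => X
  | .y => 1 - X

theorem letterDenom_ne_zero (a : Letter) : letterDenom a ≠ 0 := by
  intro h
  cases a
  · exact X_ne_zero h
  · simpa [letterDenom] using congrArg constantCoeff h

/-- A power series can be integrated against the form of a letter when the result has no
logarithmic term. -/
def Integrates (a : Letter) (f : ℝ⟦X⟧) : Prop := a = .x → constantCoeff f = 0

theorem letterDenom_mul_derivative (a : Letter) (f : ℝ⟦X⟧) (h : Integrates a f) :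
    letterDenom a * derivative ℝ (letterIntegral a f) = f := by
  cases a
  · ext n
    cases n with
    | zero => simp [letterDenom, h rfl]
    | succ n =>
      rw [letterDenom, mul_comm, coeff_succ_mul_X, coeff_derivative, coeff_letterIntegral_x]
      have : (n : ℝ) + 1 ≠ 0 := by positivity
      push_cast
      field_simp
  · have key (n : ℕ) :
        coeff n (derivative ℝ (letterIntegral .y f)) = ∑ m ∈ range (n + 1), coeff m f := by
      rw [coeff_derivative, coeff_letterIntegral_y]
      have : (n : ℝ) + 1 ≠ 0 := by positivity
      push_cast
      field_simp
    ext n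
    rw [letterDenom, sub_mul, one_mul, map_sub, mul_comm]
    cases n with
    | zero => simp [key]
    | succ n => rw [coeff_succ_mul_X, key, key, sum_range_succ]; ring

/-- Integration by parts (the Rota–Baxter identity). -/
theorem letterIntegral_mul_letterIntegral (a b : Letter) (f g : ℝ⟦X⟧)
    (hf : Integrates a f) (hg : Integrates b g) :
    letterIntegral a f * letterIntegral b g =
      letterIntegral a (f * letterIntegral b g) + letterIntegral b (letterIntegral a f * g) := by
  -- Both sides have zero constant term, so it suffices to compare derivatives; multiplying by both
  -- denominators clears the forms and leaves the Leibniz rule.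
  refine derivative.ext ?_ (by simp)
  refine mul_left_cancel₀ (mul_ne_zero (letterDenom_ne_zero a) (letterDenom_ne_zero b)) ?_
  have h1 := letterDenom_mul_derivative a f hf
  have h2 := letterDenom_mul_derivative b g hg
  have h3 := letterDenom_mul_derivative a (f * letterIntegral b g) (fun _ => by simp)
  have h4 := letterDenom_mul_derivative b (letterIntegral a f * g) (fun _ => by simp)
  rw [Derivation.leibniz, map_add]
  simp only [smul_eq_mul]
  linear_combination (letterDenom b * letterIntegral b g) * h1 +
    (letterDenom a * letterIntegral a f) * h2 - letterDenom b * h3 - letterDenom a * h4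

/-- The generating series of a word: its iterated integral, expanded at `0`. -/
def wordSeries : List Letter → ℝ⟦X⟧
  | [] => 1
  | a :: w => letterIntegral a (wordSeries w)

theorem constantCoeff_wordSeries {w : List Letter} (hw : w ≠ []) :
    constantCoeff (wordSeries w) = 0 := by
  cases w with
  | nil => exact absurd rfl hw
  | cons a w => simp [wordSeries]

/-- The linear extension of `wordSeries`. -/
def series : H →ₗ[ℚ] ℝ⟦X⟧ := Finsupp.linearCombination ℚ wordSeries

@[simp]
theorem series_single (w : List Letter) : series (Finsupp.single w 1) = wordSeries w := by
  simp [series]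

theorem series_mapDomain_cons (a : Letter) (f : H) :
    series (Finsupp.mapDomain (List.cons a) f) = letterIntegral a (series f) := by
  induction f using Finsupp.induction_linear with
  | zero => simp
  | add f g hf hg => simp [Finsupp.mapDomain_add, hf, hg]
  | single w c =>
    rw [Finsupp.mapDomain_single]
    simp only [series, Finsupp.linearCombination_single, wordSeries]
    exact (map_rat_smul (letterIntegral a) c (wordSeries w)).symm

theorem tail_mem_wordsH1 {a : Letter} {w : List Letter} (h : a :: w ∈ wordsH1) :
    w ∈ wordsH1 := by
  cases w with
  | nil => simp [wordsH1]
  | cons d w => simpa [wordsH1, List.getLast?_cons_cons] using h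

theorem cons_mem_wordsH1 (a : Letter) {w : List Letter} (h : w ∈ wordsH1) (hw : w ≠ []) :
    a :: w ∈ wordsH1 := by
  cases w with
  | nil => exact absurd rfl hw
  | cons d w => simpa [wordsH1, List.getLast?_cons_cons] using h

theorem ne_nil_of_x_cons_mem {w : List Letter} (h : .x :: w ∈ wordsH1) : w ≠ [] := by
  rintro rfl
  simp [wordsH1] at h

theorem integrates_wordSeries {a : Letter} {w : List Letter} (h : a :: w ∈ wordsH1) :
    Integrates a (wordSeries w) := by
  rintro rfl
  exact constantCoeff_wordSeries (ne_nil_of_x_cons_mem h)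

/-- The shuffle recursion is the Rota–Baxter identity letter by letter. Membership in `wordsH1`
ensures that `x` is only integrated against series without constant term, so no logarithm is lost.
-/
theorem wordSeries_mul : ∀ u v : List Letter, u ∈ wordsH1 → v ∈ wordsH1 →
    wordSeries u * wordSeries v = series (shuffleWord u v)
  | [], v, _, _ => by simp [shuffleWord, wordSeries]
  | a :: u, [], _, _ => by simp [shuffleWord, wordSeries]
  | a :: u, b :: v, hu, hv => by
    rw [shuffleWord, map_add, series_mapDomain_cons, series_mapDomain_cons,
      ← wordSeries_mul u (b :: v) (tail_mem_wordsH1 hu) hv,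
      ← wordSeries_mul (a :: u) v hu (tail_mem_wordsH1 hv)]
    exact letterIntegral_mul_letterIntegral a b _ _ (integrates_wordSeries hu)
      (integrates_wordSeries hv)
termination_by u v => u.length + v.length

theorem series_shuffle (f g : H) (hf : f ∈ H1) (hg : g ∈ H1) :
    series (shuffle f g) = series f * series g := by
  rw [H1, Finsupp.mem_supported] at hf hg
  have e (h : H) : series h = ∑ u ∈ h.support, h u • wordSeries u := by
    rw [series, Finsupp.linearCombination_apply, Finsupp.sum]
  rw [e f, e g, Finset.sum_mul_sum]
  simp only [shuffle, Finsupp.linearCombination_apply, Finsupp.sum, LinearMap.sum_apply,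
    LinearMap.smul_apply, map_sum, map_smul]
  refine sum_congr rfl fun u hu => ?_
  rw [smul_sum]
  refine sum_congr rfl fun v hv => ?_
  rw [smul_mul_smul_comm, wordSeries_mul u v (hf hu) (hg hv), mul_smul]

/-! ### The words `yⁿ` and `yⁿ x w` -/

/-- The series of the word `yⁿ`, that is `(-log (1 - z)) ^ n / n!`. -/
def logSeries (n : ℕ) : ℝ⟦X⟧ := wordSeries (List.replicate n .y)

@[simp]
theorem logSeries_zero : logSeries 0 = 1 := rfl

theorem logSeries_succ (n : ℕ) : logSeries (n + 1) = letterIntegral .y (logSeries n) := rfl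

theorem integrates_y (f : ℝ⟦X⟧) : Integrates .y f := by
  intro h; cases h

theorem logSeries_one_mul (n : ℕ) :
    logSeries 1 * logSeries n = ((n : ℝ) + 1) • logSeries (n + 1) := by
  induction n with
  | zero => simp
  | succ n ih =>
    rw [logSeries_succ 0, logSeries_succ n, letterIntegral_mul_letterIntegral _ _ _ _
      (integrates_y _) (integrates_y _), ← logSeries_succ, ← logSeries_succ, ih, map_smul,
      ← logSeries_succ, logSeries_zero, one_mul, ← logSeries_succ]
    push_cast
    module

theorem logSeries_one_pow (n : ℕ) : logSeries 1 ^ n = (n.factorial : ℝ) • logSeries n := by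
  induction n with
  | zero => simp
  | succ n ih =>
    rw [pow_succ', ih, mul_smul_comm, logSeries_one_mul, smul_smul, Nat.factorial_succ]
    push_cast
    ring_nf

theorem logSeries_eq (n : ℕ) : logSeries n = (n.factorial : ℝ)⁻¹ • logSeries 1 ^ n := by
  rw [logSeries_one_pow, smul_smul, inv_mul_cancel₀ (by positivity), one_smul]

/-- Binomial expansion of `(-L + L) ^ (n + 1) = 0` for `L = logSeries 1`, divided by `(n + 1)!`. -/
theorem sum_logSeries_mul_logSeries (n : ℕ) :
    ∑ j ∈ range (n + 2), (-1 : ℝ) ^ j • (logSeries (n + 1 - j) * logSeries j) = 0 := by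
  have h := add_pow (-logSeries 1) (logSeries 1) (n + 1)
  rw [neg_add_cancel, zero_pow n.succ_ne_zero] at h
  have h2 : (((n + 1).factorial : ℝ)) •
      ∑ j ∈ range (n + 2), (-1 : ℝ) ^ j • (logSeries (n + 1 - j) * logSeries j) = 0 := by
    rw [h, smul_sum]
    refine sum_congr rfl fun j hj => ?_
    have hj : j ≤ n + 1 := Nat.lt_succ_iff.1 (mem_range.1 hj)
    have hc : (((n + 1).factorial : ℝ)) =
        (n + 1).choose j * (j.factorial * (n + 1 - j).factorial) := by
      rw [← Nat.choose_mul_factorial_mul_factorial hj]; push_cast; ring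
    have hcast : (((n + 1).choose j : ℕ) : ℝ⟦X⟧) = C (((n + 1).choose j : ℕ) : ℝ) := by simp
    rw [neg_pow (logSeries 1), logSeries_one_pow, logSeries_one_pow, hc, hcast]
    simp only [PowerSeries.smul_eq_C_mul, map_mul, map_pow, map_neg, map_one]
    ring
  exact (smul_eq_zero.1 h2).resolve_left (by positivity)

/-- Shuffle regularization of a word `yⁿ x w`, at the level of series. -/
theorem wordSeries_replicate_append (n : ℕ) (w : List Letter) (hw : .x :: w ∈ wordsH1) :
    wordSeries (List.replicate n .y ++ .x :: w) =
      ∑ j ∈ range (n + 1), (-1 : ℝ) ^ j •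
        (logSeries (n - j) * letterIntegral .x (logSeries j * wordSeries w)) := by
  have h0 := integrates_wordSeries hw
  induction n with
  | zero => simp [wordSeries]
  | succ n ih =>
    have step (j : ℕ) (hj : j ∈ range (n + 1)) :
        (-1 : ℝ) ^ j • (logSeries (n + 1 - j) *
            letterIntegral .x (logSeries j * wordSeries w)) =
          letterIntegral .y ((-1 : ℝ) ^ j •
            (logSeries (n - j) * letterIntegral .x (logSeries j * wordSeries w))) +
          letterIntegral .x ((-1 : ℝ) ^ j •
            (logSeries (n + 1 - j) * logSeries j) * wordSeries w) := by
      have hj : j ≤ n := Nat.lt_succ_iff.1 (mem_range.1 hj)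
      rw [Nat.succ_sub hj, logSeries_succ, letterIntegral_mul_letterIntegral _ _ _ _
        (integrates_y _) (fun _ => by rw [map_mul, h0 rfl, mul_zero]), smul_add, map_smul,
        smul_mul_assoc, map_smul, mul_assoc]
    rw [sum_range_succ, sum_congr rfl step, sum_add_distrib, ← map_sum, ← map_sum, ← ih,
      add_assoc, ← sum_mul]
    -- The `y`-parts have already been collected by the induction hypothesis; the alternating
    -- identity makes the `x`-parts cancel the remaining term `j = n + 1`.
    have hz := sum_logSeries_mul_logSeries n
    rw [sum_range_succ, ← eq_neg_iff_add_eq_zero] at hz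
    rw [hz]
    simp [wordSeries, List.replicate_succ]

/-! ### Growth of coefficients -/

/-- Power series whose `n`-th coefficient is `O(1 / √n)`. -/
def slowGrowth : Submodule ℝ ℝ⟦X⟧ where
  carrier := {f | ∃ C : ℝ, ∀ n, |coeff n f| * √n ≤ C}
  zero_mem' := ⟨0, by simp⟩
  add_mem' := by
    rintro f g ⟨C, hC⟩ ⟨D, hD⟩
    refine ⟨C + D, fun n => ?_⟩
    rw [map_add]
    have := mul_le_mul_of_nonneg_right (abs_add_le (coeff n f) (coeff n g)) (Real.sqrt_nonneg n)
    linarith [hC n, hD n]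
  smul_mem' := by
    rintro c f ⟨C, hC⟩
    refine ⟨|c| * C, fun n => ?_⟩
    rw [map_smul, smul_eq_mul, abs_mul, mul_assoc]
    exact mul_le_mul_of_nonneg_left (hC n) (abs_nonneg c)

theorem sum_inv_sqrt_le (n : ℕ) : ∑ m ∈ range (n + 1), (√m)⁻¹ ≤ 2 * √n := by
  induction n with
  | zero => simp
  | succ n ih =>
    rw [sum_range_succ]
    have h1 : 0 < √(n + 1 : ℕ) := Real.sqrt_pos.2 (by positivity)
    have h2 : √n * √n = n := Real.mul_self_sqrt (by positivity)
    have h3 : √(n + 1 : ℕ) * √(n + 1 : ℕ) = n + 1 := by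
      rw [Real.mul_self_sqrt (by positivity)]; push_cast; rfl
    have h4 : (√(n + 1 : ℕ))⁻¹ ≤ 2 * √(n + 1 : ℕ) - 2 * √n := by
      rw [inv_le_iff_one_le_mul₀ h1]
      nlinarith [sq_nonneg (√(n + 1 : ℕ) - √n)]
    linarith

/-- The rate `n^{-1/2}` is stable under `y`, since partial sums are `O(√n)` and are then divided by
`n`; the rate `1 / n` would pick up logarithms. It still leaves `n^{-3/2}`, hence summability, after
one `x`. -/
theorem letterIntegral_mem_slowGrowth (a : Letter) {f : ℝ⟦X⟧} (hf : f ∈ slowGrowth) :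
    letterIntegral a f ∈ slowGrowth := by
  obtain ⟨C, hC⟩ := hf
  cases a
  · refine ⟨C, fun n => ?_⟩
    rw [coeff_letterIntegral_x]
    rcases n.eq_zero_or_pos with rfl | hn
    · simpa using hC 0
    have : (1 : ℝ) ≤ n := by exact_mod_cast hn
    refine le_trans (mul_le_mul_of_nonneg_right ?_ (Real.sqrt_nonneg n)) (hC n)
    rw [abs_div, Nat.abs_cast]
    exact div_le_self (abs_nonneg _) this
  · have hC0 : 0 ≤ C := by simpa using hC 0
    -- The weight `√m` says nothing about the coefficient at `0`, and `(√0)⁻¹ = 0`, so that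
    -- coefficient is carried separately.
    have bound (m : ℕ) : |coeff m f| ≤ (if m = 0 then |coeff 0 f| else 0) + C * (√m)⁻¹ := by
      rcases m.eq_zero_or_pos with rfl | hm
      · simp
      have h1 : 0 < √m := Real.sqrt_pos.2 (by exact_mod_cast hm)
      rw [if_neg hm.ne', zero_add, ← div_eq_mul_inv, le_div_iff₀ h1]
      exact hC m
    refine ⟨|coeff 0 f| + 2 * C, fun n => ?_⟩
    rw [coeff_letterIntegral_y]
    rcases n.eq_zero_or_pos with rfl | hn
    · simp; positivity
    have hn1 : (1 : ℝ) ≤ √n := Real.one_le_sqrt.2 (by exact_mod_cast hn)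
    have hn0 : 0 < √(n : ℝ) := by linarith
    have hsq : (n : ℝ) = √n * √n := (Real.mul_self_sqrt (by positivity)).symm
    have hsum : |∑ m ∈ range n, coeff m f| ≤ |coeff 0 f| + C * (2 * √n) := by
      refine (abs_sum_le_sum_abs _ _).trans ((sum_le_sum fun m _ => bound m).trans ?_)
      rw [sum_add_distrib, ← mul_sum, sum_ite_eq' (range n) 0]
      refine add_le_add ?_ (mul_le_mul_of_nonneg_left ?_ hC0)
      · split_ifs <;> simp
      · exact (sum_le_sum_of_subset_of_nonneg (range_mono n.le_succ) fun m _ _ => by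
          positivity).trans (sum_inv_sqrt_le n)
    rw [abs_div, Nat.abs_cast]
    calc |∑ m ∈ range n, coeff m f| / n * √n = |∑ m ∈ range n, coeff m f| / √n := by
          rw [div_mul_eq_mul_div, div_eq_div_iff (by positivity) hn0.ne', mul_assoc, ← hsq]
      _ ≤ |coeff 0 f| + 2 * C := by
          rw [div_le_iff₀ hn0]
          nlinarith [abs_nonneg (coeff 0 f)]

theorem wordSeries_mem_slowGrowth (w : List Letter) : wordSeries w ∈ slowGrowth := by
  induction w with
  | nil =>
    refine ⟨0, fun n => ?_⟩
    rcases n.eq_zero_or_pos with rfl | hn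
    · simp
    · simp [wordSeries, coeff_one, hn.ne']
  | cons a w ih => exact letterIntegral_mem_slowGrowth a ih

theorem series_mem_slowGrowth (f : H) : series f ∈ slowGrowth := by
  rw [series, Finsupp.linearCombination_apply, Finsupp.sum]
  refine Submodule.sum_mem _ fun w _ => ?_
  rw [← Rat.cast_smul_eq_qsmul ℝ]
  exact Submodule.smul_mem _ _ (wordSeries_mem_slowGrowth w)

/-! ### Evaluation on the unit disc -/

/-- The sum of a real power series at `z`. -/
def sumAt (f : ℝ⟦X⟧) (z : ℝ) : ℝ := ∑' n, coeff n f * z ^ n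

/-- Absolute convergence on the open unit disc. -/
def ConvergesOnDisc (f : ℝ⟦X⟧) : Prop :=
  ∀ z : ℝ, |z| < 1 → Summable fun n => ‖coeff n f * z ^ n‖

theorem exists_coeff_bound {f : ℝ⟦X⟧} (hf : f ∈ slowGrowth) :
    ∃ C : ℝ, ∀ n, |coeff n f| ≤ C := by
  obtain ⟨C, hC⟩ := hf
  refine ⟨max |coeff 0 f| C, fun n => ?_⟩
  rcases n.eq_zero_or_pos with rfl | hn
  · exact le_max_left _ _
  refine le_trans (le_trans ?_ (hC n)) (le_max_right _ _)
  exact le_mul_of_one_le_right (abs_nonneg _) (Real.one_le_sqrt.2 (by exact_mod_cast hn))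

theorem convergesOnDisc_of_mem_slowGrowth {f : ℝ⟦X⟧} (hf : f ∈ slowGrowth) :
    ConvergesOnDisc f := by
  obtain ⟨C, hC⟩ := exists_coeff_bound hf
  intro z hz
  refine Summable.of_nonneg_of_le (fun n => norm_nonneg _) (fun n => ?_)
    ((summable_geometric_of_lt_one (abs_nonneg z) hz).mul_left C)
  rw [norm_mul, norm_pow]
  exact mul_le_mul_of_nonneg_right (hC n) (by positivity)

theorem ConvergesOnDisc.add {f g : ℝ⟦X⟧} (hf : ConvergesOnDisc f) (hg : ConvergesOnDisc g) :
    ConvergesOnDisc (f + g) := by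
  intro z hz
  refine Summable.of_nonneg_of_le (fun n => norm_nonneg _) (fun n => ?_)
    ((hf z hz).add (hg z hz))
  rw [map_add, add_mul]
  exact norm_add_le _ _

theorem ConvergesOnDisc.smul (c : ℝ) {f : ℝ⟦X⟧} (hf : ConvergesOnDisc f) :
    ConvergesOnDisc (c • f) := by
  intro z hz
  simpa [mul_assoc] using (hf z hz).mul_left |c|

theorem coeff_mul_mul_pow (f g : ℝ⟦X⟧) (z : ℝ) (n : ℕ) :
    coeff n (f * g) * z ^ n =
      ∑ p ∈ antidiagonal n, coeff p.1 f * z ^ p.1 * (coeff p.2 g * z ^ p.2) := by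
  rw [coeff_mul, sum_mul]
  refine sum_congr rfl fun p hp => ?_
  rw [← mem_antidiagonal.1 hp, pow_add]
  ring

theorem ConvergesOnDisc.mul {f g : ℝ⟦X⟧} (hf : ConvergesOnDisc f) (hg : ConvergesOnDisc g) :
    ConvergesOnDisc (f * g) := by
  intro z hz
  have h := summable_norm_sum_mul_antidiagonal_of_summable_norm (hf z hz) (hg z hz)
  simpa only [coeff_mul_mul_pow] using h

theorem sumAt_add {f g : ℝ⟦X⟧} (hf : ConvergesOnDisc f) (hg : ConvergesOnDisc g) {z : ℝ}
    (hz : |z| < 1) : sumAt (f + g) z = sumAt f z + sumAt g z := by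
  simp only [sumAt, map_add, add_mul]
  exact (hf z hz).of_norm.tsum_add (hg z hz).of_norm

theorem sumAt_smul (c : ℝ) (f : ℝ⟦X⟧) (z : ℝ) : sumAt (c • f) z = c * sumAt f z := by
  simp only [sumAt, map_smul, smul_eq_mul, mul_assoc, tsum_mul_left]

theorem sumAt_mul {f g : ℝ⟦X⟧} (hf : ConvergesOnDisc f) (hg : ConvergesOnDisc g) {z : ℝ}
    (hz : |z| < 1) : sumAt (f * g) z = sumAt f z * sumAt g z := by
  simp only [sumAt, coeff_mul_mul_pow]
  exact (tsum_mul_tsum_eq_tsum_sum_antidiagonal_of_summable_norm (hf z hz) (hg z hz)).symm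

theorem sumAt_zero (f : ℝ⟦X⟧) : sumAt f 0 = constantCoeff f := by
  rw [sumAt, tsum_eq_single 0 (by intro n hn; simp [hn])]
  simp

theorem sumAt_one (z : ℝ) : sumAt 1 z = 1 := by
  rw [sumAt, tsum_eq_single 0 (by intro n hn; simp [coeff_one, hn])]
  simp

theorem sumAt_eq_tsum_succ {f : ℝ⟦X⟧} (hf : constantCoeff f = 0) (z : ℝ) :
    sumAt f z = ∑' n, coeff (n + 1) f * z ^ (n + 1) := by
  rw [sumAt, ← (add_left_injective 1).tsum_eq]
  intro n hn
  cases n with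
  | zero => simp [hf] at hn
  | succ n => exact ⟨n, rfl⟩

theorem sumAt_logSeries_one {z : ℝ} (hz : |z| < 1) :
    sumAt (logSeries 1) z = -Real.log (1 - z) := by
  rw [← (Real.hasSum_pow_div_log_of_abs_lt_one hz).tsum_eq,
    sumAt_eq_tsum_succ (f := logSeries 1) (constantCoeff_wordSeries (by simp))]
  refine tsum_congr fun n => ?_
  rw [logSeries_succ, coeff_letterIntegral_y]
  simp [coeff_one]
  ring

/-- Termwise differentiation under a geometric bound on a smaller disc. Writing the derivative
through `z * d` avoids dividing by `z`, so that `z = 0` is covered; continuity at the endpoint `t =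
0` needs this. -/
theorem hasDerivAt_sumAt_letterIntegral_x {f : ℝ⟦X⟧} (hf : f ∈ slowGrowth) {z : ℝ}
    (hz : |z| < 1) : ∃ d, HasDerivAt (sumAt (letterIntegral .x f)) d z ∧
      (constantCoeff f = 0 → z * d = sumAt f z) := by
  obtain ⟨C, hC⟩ := exists_coeff_bound hf
  obtain ⟨r, hzr, hr⟩ := exists_between hz
  have hr0 : 0 ≤ r := (abs_nonneg z).trans hzr.le
  have hC0 : 0 ≤ C := (abs_nonneg _).trans (hC 0)
  have key : HasDerivAt (fun y => ∑' n, coeff (n + 1) (letterIntegral .x f) * y ^ (n + 1))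
      (∑' n, coeff (n + 1) f * z ^ n) z := by
    refine hasDerivAt_tsum_of_isPreconnected
      (g' := fun n y => coeff (n + 1) f * y ^ n) (u := fun n => C * r ^ n) (t := Set.Ioo (-r) r)
      (y₀ := 0) ((summable_geometric_of_lt_one hr0 hr).mul_left C) isOpen_Ioo
      isPreconnected_Ioo ?_ ?_ ?_ ?_ (abs_lt.1 hzr)
    · intro n y _
      have h := (hasDerivAt_pow (n + 1) y).const_mul (coeff (n + 1) (letterIntegral .x f))
      refine h.congr_deriv ?_
      rw [coeff_letterIntegral_x]
      have : (n : ℝ) + 1 ≠ 0 := by positivity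
      push_cast
      field_simp
    · intro n y hy
      rw [norm_mul, norm_pow]
      exact mul_le_mul (hC _) (pow_le_pow_left₀ (norm_nonneg y) (abs_lt.2 hy).le n)
        (by positivity) hC0
    · exact abs_lt.1 (by simpa using (abs_nonneg z).trans_lt hzr)
    · simp
  refine ⟨∑' n, coeff (n + 1) f * z ^ n, ?_, fun h0 => ?_⟩
  · exact key.congr_of_eventuallyEq (Eventually.of_forall
      (sumAt_eq_tsum_succ (constantCoeff_letterIntegral .x f)))
  · rw [sumAt_eq_tsum_succ h0, ← tsum_mul_left]
    exact tsum_congr fun n => by ring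

theorem sumAt_nonneg {f : ℝ⟦X⟧} (hf : ∀ n, 0 ≤ coeff n f) {z : ℝ} (hz : 0 ≤ z) :
    0 ≤ sumAt f z :=
  tsum_nonneg fun n => mul_nonneg (hf n) (pow_nonneg hz n)

theorem coeff_wordSeries_nonneg (w : List Letter) (n : ℕ) : 0 ≤ coeff n (wordSeries w) := by
  induction w generalizing n with
  | nil => rw [wordSeries, coeff_one]; split_ifs <;> norm_num
  | cons a w ih =>
    cases a
    · rw [wordSeries, coeff_letterIntegral_x]
      exact div_nonneg (ih n) n.cast_nonneg
    · rw [wordSeries, coeff_letterIntegral_y]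
      exact div_nonneg (sum_nonneg fun m _ => ih m) n.cast_nonneg

/-! ### Asymptotic expansions at `z = 1` -/

/-- A function that is negligible against all powers at `+∞`. -/
def Negligible (h : ℝ → ℝ) : Prop :=
  ∀ Q : ℝ[X], Tendsto (fun t => Q.eval t * h t) atTop (𝓝 0)

theorem negligible_of_abs_le {h : ℝ → ℝ} {M b : ℝ} (hb : 0 < b)
    (hh : ∀ t > 0, |h t| ≤ M * Real.exp (-(b * t))) : Negligible h := by
  have key (n : ℕ) : Tendsto (fun t : ℝ => t ^ n * h t) atTop (𝓝 0) := by
    have h1 : Tendsto (fun t : ℝ => M * (t ^ n / Real.exp (b * t))) atTop (𝓝 0) := by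
      simpa using (isLittleO_pow_exp_pos_mul_atTop n hb).tendsto_div_nhds_zero.const_mul M
    refine squeeze_zero_norm' ?_ h1
    filter_upwards [eventually_gt_atTop 0] with t ht
    rw [norm_mul, norm_pow, Real.norm_of_nonneg ht.le, Real.norm_eq_abs]
    calc t ^ n * |h t| ≤ t ^ n * (M * Real.exp (-(b * t))) :=
          mul_le_mul_of_nonneg_left (hh t ht) (by positivity)
      _ = _ := by rw [Real.exp_neg]; ring
  intro Q
  induction Q using Polynomial.induction_on' with
  | add p q hp hq => simpa [add_mul] using hp.add hq
  | monomial n c => simpa [mul_assoc] using (key n).const_mul c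

/-- `HasExpansion f P` says that `f` converges on the unit disc, and that
`f(z) = P(-log (1 - z))` up to a negligible error as `z → 1`; here `z = 1 - e^{-t}`. -/
structure HasExpansion (f : ℝ⟦X⟧) (P : ℝ[X]) : Prop where
  converges : ConvergesOnDisc f
  negligible : Negligible fun t => sumAt f (1 - Real.exp (-t)) - P.eval t

theorem abs_one_sub_exp_neg_lt {t : ℝ} (ht : 0 < t) : |1 - Real.exp (-t)| < 1 := by
  have h1 := Real.exp_pos (-t)
  have h2 : Real.exp (-t) < 1 := Real.exp_lt_one_iff.2 (by linarith)
  rw [abs_lt]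
  constructor <;> linarith

theorem HasExpansion.add {f g : ℝ⟦X⟧} {P Q : ℝ[X]} (hf : HasExpansion f P)
    (hg : HasExpansion g Q) : HasExpansion (f + g) (P + Q) := by
  refine ⟨hf.1.add hg.1, fun R => ?_⟩
  have h := (hf.2 R).add (hg.2 R)
  rw [add_zero] at h
  refine h.congr' ?_
  filter_upwards [eventually_gt_atTop 0] with t ht
  rw [sumAt_add hf.1 hg.1 (abs_one_sub_exp_neg_lt ht), Polynomial.eval_add]
  ring

theorem HasExpansion.smul (c : ℝ) {f : ℝ⟦X⟧} {P : ℝ[X]} (hf : HasExpansion f P) :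
    HasExpansion (c • f) (c • P) := by
  refine ⟨hf.1.smul c, fun R => ?_⟩
  have h := (hf.2 R).const_mul c
  rw [mul_zero] at h
  refine h.congr fun t => ?_
  beta_reduce
  rw [sumAt_smul, Polynomial.eval_smul, smul_eq_mul]
  ring

/-- The error is `(f - P)(g - Q) + (f - P) Q + (g - Q) P`. The last two terms explain why
negligibility is tested against all polynomials. -/
theorem HasExpansion.mul {f g : ℝ⟦X⟧} {P Q : ℝ[X]} (hf : HasExpansion f P)
    (hg : HasExpansion g Q) : HasExpansion (f * g) (P * Q) := by
  refine ⟨hf.1.mul hg.1, fun R => ?_⟩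
  have h1 := (hf.2 R).mul (hg.2 1)
  have h2 := hf.2 (R * Q)
  have h3 := hg.2 (R * P)
  have h := (h1.add h2).add h3
  simp only [mul_zero, add_zero] at h
  refine h.congr' ?_
  filter_upwards [eventually_gt_atTop 0] with t ht
  rw [sumAt_mul hf.1 hg.1 (abs_one_sub_exp_neg_lt ht)]
  simp only [Polynomial.eval_mul, Polynomial.eval_one]
  ring

theorem hasExpansion_zero : HasExpansion 0 0 :=
  ⟨fun z _ => by simp, fun R => by simp [sumAt]⟩

theorem hasExpansion_one : HasExpansion 1 1 :=
  ⟨convergesOnDisc_of_mem_slowGrowth (wordSeries_mem_slowGrowth []),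
    fun R => by simp [sumAt_one]⟩

theorem HasExpansion.sum {ι : Type*} (s : Finset ι) {f : ι → ℝ⟦X⟧} {P : ι → ℝ[X]}
    (h : ∀ i ∈ s, HasExpansion (f i) (P i)) : HasExpansion (∑ i ∈ s, f i) (∑ i ∈ s, P i) := by
  classical
  induction s using Finset.induction_on with
  | empty => exact hasExpansion_zero
  | insert a s ha ih =>
    rw [sum_insert ha, sum_insert ha]
    exact (h a (mem_insert_self a s)).add (ih fun i hi => h i (mem_insert_of_mem hi))

theorem HasExpansion.pow {f : ℝ⟦X⟧} {P : ℝ[X]} (hf : HasExpansion f P) (n : ℕ) :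
    HasExpansion (f ^ n) (P ^ n) := by
  induction n with
  | zero => exact hasExpansion_one
  | succ n ih => simpa only [pow_succ] using ih.mul hf

/-- A polynomial tending to `0` at infinity vanishes. -/
theorem HasExpansion.unique {f : ℝ⟦X⟧} {P Q : ℝ[X]} (hP : HasExpansion f P)
    (hQ : HasExpansion f Q) : P = Q := by
  have h := (hQ.2 1).sub (hP.2 1)
  simp only [Polynomial.eval_one, one_mul, sub_sub_sub_cancel_left, sub_zero] at h
  have h' : Tendsto (fun t => (P - Q).eval t) atTop (𝓝 0) := by
    simpa only [Polynomial.eval_sub] using h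
  have h0 := ((P - Q).tendsto_nhds_iff.1 h').1
  exact sub_eq_zero.1 (Polynomial.leadingCoeff_eq_zero.1 h0)

theorem hasExpansion_logSeries (n : ℕ) :
    HasExpansion (logSeries n) ((n.factorial : ℝ)⁻¹ • Polynomial.X ^ n) := by
  rw [logSeries_eq]
  -- `M := 0` because the expansion of `-log (1 - z)` is exact.
  refine (HasExpansion.pow ⟨convergesOnDisc_of_mem_slowGrowth (wordSeries_mem_slowGrowth _),
    negligible_of_abs_le (M := 0) one_pos fun t ht => ?_⟩ n).smul _
  rw [← logSeries, sumAt_logSeries_one (abs_one_sub_exp_neg_lt ht)]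
  simp

theorem sumAt_logSeries (n : ℕ) {t : ℝ} (ht : 0 < t) :
    sumAt (logSeries n) (1 - Real.exp (-t)) = t ^ n / n.factorial := by
  have hz := abs_one_sub_exp_neg_lt ht
  have h1 : ConvergesOnDisc (logSeries 1) :=
    convergesOnDisc_of_mem_slowGrowth (wordSeries_mem_slowGrowth _)
  have h (n : ℕ) : ConvergesOnDisc (logSeries 1 ^ n) ∧
      sumAt (logSeries 1 ^ n) (1 - Real.exp (-t)) = t ^ n := by
    induction n with
    | zero => exact ⟨hasExpansion_one.1, by simp [sumAt_one]⟩
    | succ n ih =>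
      rw [pow_succ, sumAt_mul ih.1 h1 hz, ih.2, sumAt_logSeries_one hz]
      exact ⟨ih.1.mul h1, by simp [pow_succ]⟩
  rw [logSeries_eq, sumAt_smul, (h n).2]
  ring

/-- Interpolation between the trivial bound `1` and Bernoulli's bound `n (1 - z)`. An exponent below
`1/2` is needed for `n^{-3/2}` times the resulting power of `n` to be summable; `1/4` leaves
`n^{-5/4}`. -/
theorem one_sub_pow_le {z : ℝ} (h0 : 0 ≤ z) (h1 : z ≤ 1) (n : ℕ) :
    1 - z ^ n ≤ (n : ℝ) ^ (1 / 4 : ℝ) * (1 - z) ^ (1 / 4 : ℝ) := by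
  have hb : 1 - z ^ n ≤ n * (1 - z) := by
    have := one_add_mul_le_pow (a := z - 1) (by linarith) n
    rw [add_sub_cancel] at this
    linarith
  have hp : z ^ n ≤ 1 := pow_le_one₀ h0 h1
  have hq : 0 ≤ z ^ n := pow_nonneg h0 n
  rw [← Real.mul_rpow n.cast_nonneg (by linarith)]
  calc 1 - z ^ n = (1 - z ^ n) ^ (1 : ℝ) := (Real.rpow_one _).symm
    _ ≤ (1 - z ^ n) ^ (1 / 4 : ℝ) :=
        Real.rpow_le_rpow_of_exponent_ge' (by linarith) (by linarith) (by norm_num) (by norm_num)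
    _ ≤ _ := Real.rpow_le_rpow (by linarith) hb (by norm_num)

/-- The coefficients `c_n` are `O(n^{-3/2})`, so the series converges at `1`, and by
`one_sub_pow_le` the error is at most `∑ |c_n| n^{1/4}` times `(1 - z)^{1/4} = e^{-t/4}`. -/
theorem hasExpansion_letterIntegral_x {f : ℝ⟦X⟧} (hf : f ∈ slowGrowth) :
    HasExpansion (letterIntegral .x f) (Polynomial.C (sumAt (letterIntegral .x f) 1)) := by
  have hconv := convergesOnDisc_of_mem_slowGrowth (letterIntegral_mem_slowGrowth .x hf)
  set c : ℕ → ℝ := fun n => coeff n (letterIntegral .x f) with hc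
  have hsum : Summable fun n => |c n| * (n : ℝ) ^ (1 / 4 : ℝ) := by
    obtain ⟨C, hC⟩ := hf
    refine Summable.of_nonneg_of_le (fun n => by positivity) (fun n => ?_)
      ((Real.summable_one_div_nat_rpow (p := 5 / 4)).2 (by norm_num) |>.mul_left C)
    simp only [hc, coeff_letterIntegral_x]
    rcases n.eq_zero_or_pos with rfl | hn
    · simp [Real.zero_rpow]
    have hn' : (0 : ℝ) < n := by exact_mod_cast hn
    have h54 : (n : ℝ) * √n = n ^ (1 / 4 : ℝ) * n ^ (5 / 4 : ℝ) := by
      rw [Real.sqrt_eq_rpow, ← Real.rpow_add hn', ← Real.rpow_one_add' hn'.le (by norm_num)]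
      norm_num
    rw [abs_div, Nat.abs_cast, mul_one_div, le_div_iff₀ (by positivity), mul_assoc, ← h54]
    calc |coeff n f| / n * (n * √n) = |coeff n f| * √n := by field_simp
      _ ≤ C := hC n
  have hsum1 : Summable fun n => c n * 1 ^ n := by
    refine Summable.of_norm_bounded hsum fun n => ?_
    rcases n.eq_zero_or_pos with rfl | hn
    · simp [hc]
    rw [one_pow, mul_one, Real.norm_eq_abs]
    exact le_mul_of_one_le_right (abs_nonneg _)
      (Real.one_le_rpow (by exact_mod_cast hn) (by norm_num))
  refine ⟨hconv, negligible_of_abs_le (M := ∑' n, |c n| * (n : ℝ) ^ (1 / 4 : ℝ))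
    (b := 1 / 4) (by norm_num) fun t ht => ?_⟩
  have hz := abs_one_sub_exp_neg_lt ht
  set z := 1 - Real.exp (-t) with hzdef
  have hz0 : 0 ≤ z := by
    have : Real.exp (-t) < 1 := Real.exp_lt_one_iff.2 (by linarith)
    linarith
  have hz1 : z ≤ 1 := (abs_lt.1 hz).2.le
  have hexp : Real.exp (-(1 / 4 * t)) = (1 - z) ^ (1 / 4 : ℝ) := by
    rw [hzdef, sub_sub_cancel, ← Real.exp_mul]
    ring_nf
  rw [Polynomial.eval_C, sumAt, sumAt, ← (hconv z hz).of_norm.tsum_sub hsum1, hexp,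
    ← tsum_mul_right, ← Real.norm_eq_abs]
  refine tsum_of_norm_bounded (hsum.mul_right _).hasSum fun n => ?_
  rw [← mul_sub, norm_mul, Real.norm_eq_abs, mul_assoc]
  refine mul_le_mul_of_nonneg_left ?_ (abs_nonneg _)
  have hp : z ^ n ≤ 1 := pow_le_one₀ hz0 hz1
  rw [one_pow, Real.norm_eq_abs, abs_sub_comm, abs_of_nonneg (by linarith)]
  exact one_sub_pow_le hz0 hz1 n

/-! ### Words of indices -/

theorem pnat_sub_one_add_one (a : ℕ+) : (a : ℕ) - 1 + 1 = a :=
  Nat.sub_add_cancel (Nat.succ_le_of_lt a.pos)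

theorem indexWord_append (k l : MZIndex) : indexWord (k ++ l) = indexWord l ++ indexWord k := by
  simp [indexWord]

theorem indexWord_reverse_cons (a : ℕ+) (l : List ℕ+) :
    indexWord (a :: l).reverse =
      List.replicate ((a : ℕ) - 1) .x ++ .y :: indexWord l.reverse := by
  simp [indexWord]

theorem coeff_wordSeries_replicate_x (j : ℕ) (w : List Letter) (n : ℕ) :
    coeff n (wordSeries (List.replicate j .x ++ w)) = coeff n (wordSeries w) / (n : ℝ) ^ j := by
  induction j with
  | zero => simp
  | succ j ih =>
    rw [List.replicate_succ, List.cons_append, wordSeries, coeff_letterIntegral_x, ih, pow_succ,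
      div_div]

/-- Coefficients and their partial sums determine each other recursively; taking the partial sums as
a hypothesis lets one induction on `l` settle both. -/
theorem coeff_wordSeries_indexWord_of_sum {l : List ℕ+}
    (h : ∀ n, 1 ≤ n → ∑ m ∈ range n, coeff m (wordSeries (indexWord l.reverse)) =
      MZIndex.truncSum l n) (a : ℕ+) (n : ℕ) :
    coeff n (wordSeries (indexWord (a :: l).reverse)) =
      MZIndex.truncSum l n / (n : ℝ) ^ (a : ℕ) := by
  rw [indexWord_reverse_cons, coeff_wordSeries_replicate_x, wordSeries, coeff_letterIntegral_y,
    div_div, ← pow_succ', pnat_sub_one_add_one]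
  rcases n.eq_zero_or_pos with rfl | hn
  · simp
  · rw [h n hn]

theorem sum_coeff_wordSeries_indexWord (l : List ℕ+) (n : ℕ) (hn : 1 ≤ n) :
    ∑ m ∈ range n, coeff m (wordSeries (indexWord l.reverse)) = MZIndex.truncSum l n := by
  induction l generalizing n with
  | nil => simp [indexWord, wordSeries, MZIndex.truncSum, coeff_one, Nat.pos_iff_ne_zero.1 hn]
  | cons a l ih =>
    simp only [coeff_wordSeries_indexWord_of_sum ih]
    -- The extra term `m = 0` is a division by `0 ^ a = 0`, hence zero.
    rw [MZIndex.truncSum, range_eq_Ico, sum_eq_sum_Ico_succ_bot hn]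
    simp

theorem coeff_wordSeries_indexWord (a : ℕ+) (l : List ℕ+) (n : ℕ) :
    coeff n (wordSeries (indexWord (a :: l).reverse)) =
      MZIndex.truncSum l n / (n : ℝ) ^ (a : ℕ) :=
  coeff_wordSeries_indexWord_of_sum (sum_coeff_wordSeries_indexWord l) a n

theorem indexWord_ne_nil {k : MZIndex} (hk : k ≠ []) : indexWord k ≠ [] := by
  obtain ⟨l, rfl⟩ := List.reverse_surjective k
  cases l with
  | nil => exact absurd rfl hk
  | cons a l => rw [indexWord_reverse_cons]; simp

/-- The two series agree term by term, so no convergence is required. -/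
theorem polylog_eq_sumAt (k : MZIndex) (z : ℝ) :
    k.polylog z = sumAt (wordSeries (indexWord k)) z := by
  obtain ⟨l, rfl⟩ := List.reverse_surjective k
  cases l with
  | nil => simp [MZIndex.polylog, indexWord, wordSeries, sumAt_one]
  | cons a l =>
    rw [sumAt_eq_tsum_succ (constantCoeff_wordSeries (indexWord_ne_nil (by simp))),
      MZIndex.polylog, List.reverse_reverse]
    refine tsum_congr fun n => ?_
    rw [coeff_wordSeries_indexWord]
    ring

/-- Prepending `x` raises the last entry of the index by one, and prepending `y` appends an entry
`1`. -/
theorem exists_indexWord_eq (w : List Letter) (hw : w ∈ wordsH1) :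
    ∃ k : MZIndex, indexWord k = w ∧ (w.head? ≠ some .y → k.Admissible) := by
  suffices h : ∃ l : List ℕ+, indexWord l.reverse = w ∧
      (w.head? ≠ some .y → ∀ a ∈ l.head?, 2 ≤ a) by
    obtain ⟨l, h1, h2⟩ := h
    exact ⟨l.reverse, h1, fun h => by simpa [MZIndex.Admissible] using h2 h⟩
  induction w with
  | nil => exact ⟨[], by simp [indexWord], by simp⟩
  | cons c w ih =>
    obtain ⟨l, hl, -⟩ := ih (tail_mem_wordsH1 hw)
    cases c
    · cases l with
      | nil => exact absurd hl.symm (ne_nil_of_x_cons_mem hw)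
      | cons a l =>
        refine ⟨(a + 1) :: l, ?_, fun _ b hb => ?_⟩
        · rw [← hl, indexWord_reverse_cons, indexWord_reverse_cons, ← List.cons_append,
            ← List.replicate_succ, PNat.add_coe, PNat.one_coe, Nat.add_sub_cancel,
            pnat_sub_one_add_one]
        · simp only [List.head?_cons, Option.mem_def, Option.some.injEq] at hb
          rw [← hb, ← PNat.coe_le_coe, PNat.add_coe]
          exact Nat.succ_le_succ a.2
    · exact ⟨1 :: l, by rw [indexWord_reverse_cons, hl]; simp, by simp⟩

theorem exists_eq_x_cons_of_admissible {k : MZIndex} (hk : k.Admissible) (h : k ≠ []) :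
    ∃ w, indexWord k = .x :: w := by
  obtain ⟨l, rfl⟩ := List.reverse_surjective k
  cases l with
  | nil => exact absurd rfl h
  | cons a l =>
    have ha : 2 ≤ a := hk a (by simp)
    have ha' : 2 ≤ (a : ℕ) := by exact_mod_cast ha
    obtain ⟨j, hj⟩ : ∃ j, (a : ℕ) - 1 = j + 1 := ⟨a - 2, by omega⟩
    rw [indexWord_reverse_cons, hj, List.replicate_succ]
    exact ⟨_, rfl⟩

theorem plus_append_singleton (l : MZIndex) (a : ℕ+) :
    MZIndex.plus (l ++ [a]) = l ++ [a + 1] := by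
  induction l with
  | nil => rfl
  | cons b l ih =>
    cases l with
    | nil => rfl
    | cons c l => simpa [MZIndex.plus] using ih

theorem indexWord_plus_append {k : MZIndex} (hk : k ≠ []) (n : ℕ) :
    indexWord (k.plus ++ List.replicate n 1) =
      List.replicate n .y ++ .x :: indexWord k := by
  have h1 (k : MZIndex) : indexWord (k ++ List.replicate n 1) =
      List.replicate n .y ++ indexWord k := by
    induction n with
    | zero => simp
    | succ n ih =>
      rw [List.replicate_succ', ← List.append_assoc, indexWord_append, ih]
      simp [indexWord, List.replicate_succ]
  rw [h1]
  congr 1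
  obtain ⟨l, rfl⟩ := List.reverse_surjective k
  cases l with
  | nil => exact absurd rfl hk
  | cons a l =>
    rw [List.reverse_cons, plus_append_singleton, ← List.reverse_cons, ← List.reverse_cons,
      indexWord_reverse_cons, indexWord_reverse_cons, ← List.cons_append,
      ← List.replicate_succ, PNat.add_coe, PNat.one_coe, Nat.add_sub_cancel,
      pnat_sub_one_add_one]

/-! ### Existence of the regularization map -/

theorem replicate_y_mem_wordsH1 (n : ℕ) : List.replicate n .y ∈ wordsH1 := by
  intro a ha
  exact List.eq_of_mem_replicate (List.mem_of_getLast? ha)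

/-- Slow growth is not obviously preserved by products; here the product is a combination of word
series by the shuffle formula. -/
theorem logSeries_mul_mem_slowGrowth (n : ℕ) {w : List Letter} (hw : w ∈ wordsH1) :
    logSeries n * wordSeries w ∈ slowGrowth := by
  rw [logSeries, wordSeries_mul _ _ (replicate_y_mem_wordsH1 n) hw]
  exact series_mem_slowGrowth _

theorem hasExpansion_replicate_append (n : ℕ) (w : List Letter) (hw : .x :: w ∈ wordsH1) :
    HasExpansion (wordSeries (List.replicate n .y ++ .x :: w))
      (∑ j ∈ range (n + 1), (-1 : ℝ) ^ j • (((n - j).factorial : ℝ)⁻¹ • Polynomial.X ^ (n - j) *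
        Polynomial.C (sumAt (letterIntegral .x (logSeries j * wordSeries w)) 1))) := by
  rw [wordSeries_replicate_append n w hw]
  exact HasExpansion.sum _ fun j _ => ((hasExpansion_logSeries _).mul
    (hasExpansion_letterIntegral_x (logSeries_mul_mem_slowGrowth j (tail_mem_wordsH1 hw)))).smul _

theorem exists_replicate_y (w : List Letter) :
    ∃ n, w = List.replicate n .y ∨ ∃ v, w = List.replicate n .y ++ .x :: v := by
  induction w with
  | nil => exact ⟨0, .inl rfl⟩
  | cons a w ih =>
    cases a
    · exact ⟨0, .inr ⟨w, rfl⟩⟩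
    · obtain ⟨n, rfl | ⟨v, rfl⟩⟩ := ih
      · exact ⟨n + 1, .inl rfl⟩
      · exact ⟨n + 1, .inr ⟨v, rfl⟩⟩

theorem mem_wordsH1_of_replicate_append {n : ℕ} {w : List Letter}
    (h : List.replicate n .y ++ w ∈ wordsH1) : w ∈ wordsH1 := by
  induction n with
  | zero => exact h
  | succ n ih => exact ih (tail_mem_wordsH1 h)

theorem exists_hasExpansion (w : List Letter) (hw : w ∈ wordsH1) :
    ∃ P, HasExpansion (wordSeries w) P := by
  obtain ⟨n, rfl | ⟨v, rfl⟩⟩ := exists_replicate_y w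
  · exact ⟨_, hasExpansion_logSeries n⟩
  · exact ⟨_, hasExpansion_replicate_append n v (mem_wordsH1_of_replicate_append hw)⟩

/-- The map sending a word to the asymptotic expansion of its iterated integral. -/
def expansion : H →ₗ[ℚ] ℝ[X] :=
  Finsupp.linearCombination ℚ fun w => Classical.epsilon (HasExpansion (wordSeries w))

theorem hasExpansion_series (f : H) (hf : f ∈ H1) : HasExpansion (series f) (expansion f) := by
  rw [H1, Finsupp.mem_supported] at hf
  simp only [series, expansion, Finsupp.linearCombination_apply, Finsupp.sum]
  refine HasExpansion.sum _ fun w hw => ?_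
  rw [← Rat.cast_smul_eq_qsmul ℝ, ← Rat.cast_smul_eq_qsmul ℝ]
  exact (Classical.epsilon_spec (exists_hasExpansion w (hf hw))).smul _

theorem expansion_ofIndex {k : MZIndex} {P : ℝ[X]}
    (h : HasExpansion (wordSeries (indexWord k)) P) : expansion (ofIndex k).1 = P := by
  have h1 := hasExpansion_series _ (ofIndex k).2
  rw [ofIndex, series_single] at h1
  exact h1.unique h

/-- Each property holds because an explicit expansion is known and expansions are unique. -/
theorem isRegularization_expansion : IsRegularization (expansion ∘ₗ H1.subtype) where
  map_one := expansion_ofIndex (by simpa [indexWord, wordSeries] using hasExpansion_one)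
  map_shuffle f g := by
    have h := hasExpansion_series _ (shuffleH1 f g).2
    rw [shuffleH1, series_shuffle _ _ f.2 g.2] at h
    exact h.unique ((hasExpansion_series _ f.2).mul (hasExpansion_series _ g.2))
  map_admissible k hk := by
    refine expansion_ofIndex ?_
    rw [MZIndex.mzv, polylog_eq_sumAt]
    rcases eq_or_ne k [] with rfl | h
    · simpa [indexWord, wordSeries, sumAt_one] using hasExpansion_one
    · obtain ⟨w, hw⟩ := exists_eq_x_cons_of_admissible hk h
      rw [hw, wordSeries]
      exact hasExpansion_letterIntegral_x (wordSeries_mem_slowGrowth w)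
  map_y := expansion_ofIndex (by
    simpa [indexWord, logSeries] using hasExpansion_logSeries 1)

/-! ### Uniqueness of the regularization map -/

theorem shuffleWord_y_replicate (n : ℕ) :
    shuffleWord [.y] (List.replicate n .y) =
      ((n : ℚ) + 1) • Finsupp.single (List.replicate (n + 1) .y) 1 := by
  induction n with
  | zero => simp [shuffleWord]
  | succ n ih =>
    rw [List.replicate_succ, shuffleWord, ih, shuffleWord, Finsupp.mapDomain_single,
      Finsupp.mapDomain_smul, Finsupp.mapDomain_single, ← List.replicate_succ,
      ← List.replicate_succ]
    push_cast
    module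

/-- The new `y` either joins the initial block, in `n + 1` ways, or lands after the first `x`. -/
theorem shuffleWord_y_replicate_append (n : ℕ) (w : List Letter) :
    shuffleWord [.y] (List.replicate n .y ++ .x :: w) =
      ((n : ℚ) + 1) • Finsupp.single (List.replicate (n + 1) .y ++ .x :: w) 1 +
        Finsupp.mapDomain (fun u => List.replicate n .y ++ .x :: u) (shuffleWord [.y] w) := by
  induction n with
  | zero =>
    rw [List.replicate_zero, List.nil_append, shuffleWord, shuffleWord, Finsupp.mapDomain_single]
    simp
  | succ n ih =>
    rw [List.replicate_succ, List.cons_append, shuffleWord, ih, shuffleWord,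
      Finsupp.mapDomain_single, Finsupp.mapDomain_add, Finsupp.mapDomain_smul,
      Finsupp.mapDomain_single, ← Finsupp.mapDomain_comp]
    simp only [Function.comp_def, ← List.cons_append, ← List.replicate_succ]
    push_cast
    module

theorem shuffle_single_single (u v : List Letter) :
    shuffle (Finsupp.single u 1) (Finsupp.single v 1) = shuffleWord u v := by
  simp [shuffle]

/-- The subspace where two regularization maps agree. -/
def agreement (Z₁ Z₂ : H1 →ₗ[ℚ] ℝ[X]) : Submodule ℚ H :=
  (LinearMap.eqLocus Z₁ Z₂).map H1.subtype

theorem mem_agreement {Z₁ Z₂ : H1 →ₗ[ℚ] ℝ[X]} {f : H} :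
    f ∈ agreement Z₁ Z₂ ↔ ∃ h : f ∈ H1, Z₁ ⟨f, h⟩ = Z₂ ⟨f, h⟩ := by
  simp [agreement]

section Uniqueness

variable {Z₁ Z₂ : H1 →ₗ[ℚ] ℝ[X]} (h₁ : IsRegularization Z₁) (h₂ : IsRegularization Z₂)
include h₁ h₂

theorem shuffle_mem_agreement {f g : H} (hf : f ∈ agreement Z₁ Z₂) (hg : g ∈ agreement Z₁ Z₂) :
    shuffle f g ∈ agreement Z₁ Z₂ := by
  obtain ⟨hf, ef⟩ := mem_agreement.1 hf
  obtain ⟨hg, eg⟩ := mem_agreement.1 hg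
  refine mem_agreement.2 ⟨shuffle_mem f g hf hg, ?_⟩
  have e1 := h₁.map_shuffle ⟨f, hf⟩ ⟨g, hg⟩
  have e2 := h₂.map_shuffle ⟨f, hf⟩ ⟨g, hg⟩
  rw [ef, eg, ← e2] at e1
  exact e1

theorem shuffleWord_y_mem_agreement {w : List Letter}
    (hw : Finsupp.single w 1 ∈ agreement Z₁ Z₂) : shuffleWord [.y] w ∈ agreement Z₁ Z₂ := by
  rw [← shuffle_single_single]
  refine shuffle_mem_agreement h₁ h₂ ?_ hw
  have e : indexWord [1] = [.y] := by simp [indexWord]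
  rw [← e]
  exact mem_agreement.2 ⟨(ofIndex [1]).2, h₁.map_y.trans h₂.map_y.symm⟩

theorem single_mem_agreement_of_admissible {k : MZIndex} (hk : k.Admissible) :
    Finsupp.single (indexWord k) 1 ∈ agreement Z₁ Z₂ :=
  mem_agreement.2
    ⟨(ofIndex k).2, (h₁.map_admissible k hk).trans (h₂.map_admissible k hk).symm⟩

theorem replicate_y_mem_agreement (n : ℕ) :
    Finsupp.single (List.replicate n .y) 1 ∈ agreement Z₁ Z₂ := by
  induction n with
  | zero => exact single_mem_agreement_of_admissible h₁ h₂ (k := []) (by simp [MZIndex.Admissible])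
  | succ n ih =>
    have h := shuffleWord_y_mem_agreement h₁ h₂ ih
    rw [shuffleWord_y_replicate] at h
    exact ((agreement Z₁ Z₂).smul_mem_iff (by positivity)).1 h

/-- Shuffling `y` with `yⁿ x w` gives `(n + 1) yⁿ⁺¹ x w` plus words `yⁿ x u` with shorter `y`-block
but different tails, so the induction on `n` must range over all `w`. -/
theorem replicate_y_append_mem_agreement (n : ℕ) (w : List Letter) (hw : .x :: w ∈ wordsH1) :
    Finsupp.single (List.replicate n .y ++ .x :: w) 1 ∈ agreement Z₁ Z₂ := by
  induction n generalizing w with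
  | zero =>
    obtain ⟨k, hk, ha⟩ := exists_indexWord_eq _ hw
    have := single_mem_agreement_of_admissible h₁ h₂ (ha (by simp))
    rwa [hk] at this
  | succ n ih =>
    have h := shuffleWord_y_mem_agreement h₁ h₂ (ih w hw)
    have hmap : Finsupp.mapDomain (fun u => List.replicate n .y ++ .x :: u) (shuffleWord [.y] w) ∈
        agreement Z₁ Z₂ := by
      have hs := shuffleWord_mem_aux [.y] w (replicate_y_mem_wordsH1 1) (tail_mem_wordsH1 hw)
        (.inl (by simp))
      rw [Finsupp.mem_supported] at hs
      refine Submodule.sum_mem _ fun u hu => ?_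
      obtain ⟨hu1, hu2⟩ := hs hu
      have := (agreement Z₁ Z₂).smul_mem (shuffleWord [.y] w u)
        (ih u (cons_mem_wordsH1 .x hu1 hu2))
      rwa [Finsupp.smul_single, smul_eq_mul, mul_one] at this
    rw [shuffleWord_y_replicate_append] at h
    exact ((agreement Z₁ Z₂).smul_mem_iff (by positivity)).1
      (((agreement Z₁ Z₂).add_mem_iff_left hmap).1 h)

theorem IsRegularization.unique : Z₁ = Z₂ := by
  have key : H1 ≤ agreement Z₁ Z₂ := by
    rw [H1, Finsupp.supported_eq_span_single, Submodule.span_le]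
    rintro _ ⟨w, hw, rfl⟩
    obtain ⟨n, rfl | ⟨v, rfl⟩⟩ := exists_replicate_y w
    · exact replicate_y_mem_agreement h₁ h₂ n
    · exact replicate_y_append_mem_agreement h₁ h₂ n v (mem_wordsH1_of_replicate_append hw)
  ext1 f
  exact (mem_agreement.1 (key f.2)).2

end Uniqueness

theorem regularization_eq : regularization = expansion ∘ₗ H1.subtype :=
  (Classical.epsilon_spec (p := IsRegularization) ⟨_, isRegularization_expansion⟩).unique
    isRegularization_expansion

/-- In the expansion of `yⁿ x w(k)` the `j`-th term is a multiple of `T^{n-j}`, so only `j = n`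
survives at `T = 0`. -/
theorem regMZV_plus_append {k : MZIndex} (hk : k ≠ []) (n : ℕ) :
    regMZV (k.plus ++ List.replicate n 1) = (-1) ^ n *
      sumAt (letterIntegral .x (logSeries n * wordSeries (indexWord k))) 1 := by
  have hw := cons_mem_wordsH1 .x (indexWord_mem k) (indexWord_ne_nil hk)
  have h := hasExpansion_replicate_append n (indexWord k) hw
  rw [← indexWord_plus_append hk] at h
  rw [regMZV, regPolynomial, regularization_eq, LinearMap.comp_apply, Submodule.subtype_apply,
    expansion_ofIndex h, Polynomial.finsetSum_coeff, sum_eq_single_of_mem n (self_mem_range_succ n)]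
  · rw [Polynomial.coeff_smul]
    simp
  · intro j hj hne
    have : n - j ≠ 0 := by have := mem_range.1 hj; omega
    rw [Polynomial.coeff_smul]
    simp [Polynomial.coeff_X_pow, this.symm]

/-! ### The Arakawa–Kaneko integral -/

theorem one_sub_exp_neg_pos {t : ℝ} (ht : 0 < t) : 0 < 1 - Real.exp (-t) :=
  sub_pos.2 (Real.exp_lt_one_iff.2 (by linarith))

/-- Chain rule for `z = 1 - e^{-t}`: `dz/z = dt/(e^t - 1)`, and `logSeries n` becomes `tⁿ/n!`. -/
theorem hasDerivAt_sumAt_one_sub_exp (n : ℕ) {k : MZIndex} (hk : k ≠ []) {t : ℝ} (ht : 0 < t) :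
    HasDerivAt (fun t => sumAt (letterIntegral .x (logSeries n * wordSeries (indexWord k)))
      (1 - Real.exp (-t)))
      (t ^ n / n.factorial * (k.polylog (1 - Real.exp (-t)) / (Real.exp t - 1))) t := by
  have hz := abs_one_sub_exp_neg_lt ht
  obtain ⟨d, hd, hd'⟩ := hasDerivAt_sumAt_letterIntegral_x
    (logSeries_mul_mem_slowGrowth n (indexWord_mem k)) hz
  have hmul := hd' (by rw [map_mul, constantCoeff_wordSeries (indexWord_ne_nil hk), mul_zero])
  rw [sumAt_mul (f := logSeries n) (convergesOnDisc_of_mem_slowGrowth (wordSeries_mem_slowGrowth _))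
    (convergesOnDisc_of_mem_slowGrowth (wordSeries_mem_slowGrowth _)) hz, sumAt_logSeries n ht,
    ← polylog_eq_sumAt] at hmul
  have hexp : HasDerivAt (fun t : ℝ => 1 - Real.exp (-t)) (Real.exp (-t)) t := by
    have := ((Real.hasDerivAt_exp (-t)).comp t (hasDerivAt_neg t)).const_sub 1
    exact this.congr_deriv (by ring)
  refine (hd.comp t hexp).congr_deriv ?_
  have h1 := one_sub_exp_neg_pos ht
  have h2 : 0 < Real.exp t - 1 := sub_pos.2 (Real.one_lt_exp_iff.2 ht)
  have h3 : Real.exp (-t) * (Real.exp t - 1) = 1 - Real.exp (-t) := by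
    rw [mul_sub, ← Real.exp_add, neg_add_cancel, Real.exp_zero, mul_one]
  rw [← mul_div_assoc, ← hmul, eq_div_iff h2.ne', mul_assoc, h3]
  ring

/-- The integrand is nonnegative and has an antiderivative with a finite limit at infinity, which
yields integrability together with the value; the antiderivative vanishes at `t = 0`. -/
theorem integral_pow_mul_polylog (n : ℕ) {k : MZIndex} (hk : k ≠ []) :
    IntegrableOn (fun t : ℝ => t ^ n / n.factorial *
        (k.polylog (1 - Real.exp (-t)) / (Real.exp t - 1))) (Set.Ioi 0) ∧
      ∫ t in Set.Ioi (0 : ℝ), t ^ n / n.factorial *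
        (k.polylog (1 - Real.exp (-t)) / (Real.exp t - 1)) =
      sumAt (letterIntegral .x (logSeries n * wordSeries (indexWord k))) 1 := by
  have hS := logSeries_mul_mem_slowGrowth n (indexWord_mem k)
  have hderiv : ∀ t ∈ Set.Ioi (0 : ℝ), HasDerivAt _ _ t :=
    fun t ht => hasDerivAt_sumAt_one_sub_exp n hk ht
  have hcont : ContinuousWithinAt
      (fun t => sumAt (letterIntegral .x (logSeries n * wordSeries (indexWord k)))
        (1 - Real.exp (-t))) (Set.Ici 0) 0 := by
    obtain ⟨d, hd, -⟩ := hasDerivAt_sumAt_letterIntegral_x hS (z := 1 - Real.exp (-0)) (by simp)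
    exact (ContinuousAt.comp (f := fun t : ℝ => 1 - Real.exp (-t)) hd.continuousAt
      (by fun_prop)).continuousWithinAt
  have hnonneg : ∀ t ∈ Set.Ioi (0 : ℝ), 0 ≤ t ^ n / n.factorial *
      (k.polylog (1 - Real.exp (-t)) / (Real.exp t - 1)) := by
    intro t ht
    have h0 : (0 : ℝ) < t := ht
    have h1 := sumAt_nonneg (coeff_wordSeries_nonneg (indexWord k)) (one_sub_exp_neg_pos h0).le
    rw [← polylog_eq_sumAt] at h1
    have h2 : 0 < Real.exp t - 1 := sub_pos.2 (Real.one_lt_exp_iff.2 h0)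
    positivity
  have hlim : Tendsto
      (fun t => sumAt (letterIntegral .x (logSeries n * wordSeries (indexWord k)))
        (1 - Real.exp (-t))) atTop
      (𝓝 (sumAt (letterIntegral .x (logSeries n * wordSeries (indexWord k))) 1)) := by
    have h := (hasExpansion_letterIntegral_x hS).2 1
    simp only [Polynomial.eval_one, one_mul, Polynomial.eval_C] at h
    exact tendsto_sub_nhds_zero_iff.1 h
  refine ⟨integrableOn_Ioi_deriv_of_nonneg hcont hderiv hnonneg hlim, ?_⟩
  rw [integral_Ioi_of_hasDerivAt_of_nonneg hcont hderiv hnonneg hlim]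
  simp [sumAt_zero]

theorem xiIntegrand_eq (k : MZIndex) (n : ℕ) (t : ℝ) :
    k.xiIntegrand ((n + 1 : ℕ) : ℂ) t = ((n.factorial * (t ^ n / n.factorial *
      (k.polylog (1 - Real.exp (-t)) / (Real.exp t - 1))) : ℝ) : ℂ) := by
  have h : (n.factorial : ℝ) ≠ 0 := by positivity
  rw [MZIndex.xiIntegrand, Nat.cast_succ, add_sub_cancel_right, Complex.cpow_natCast,
    ← mul_assoc, mul_div_cancel₀ _ h]
  push_cast
  ring

theorem integrableOn_xiIntegrand {k : MZIndex} (hk : k ≠ []) (n : ℕ) :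
    IntegrableOn (k.xiIntegrand ((n + 1 : ℕ) : ℂ)) (Set.Ioi 0) := by
  rw [funext (xiIntegrand_eq k n)]
  exact ((integral_pow_mul_polylog n hk).1.const_mul _).ofReal

theorem xi_natCast {k : MZIndex} (hk : k ≠ []) (n : ℕ) :
    k.xi ((n + 1 : ℕ) : ℂ) =
      (sumAt (letterIntegral .x (logSeries n * wordSeries (indexWord k))) 1 : ℝ) := by
  have h : (n.factorial : ℂ) ≠ 0 := by exact_mod_cast n.factorial_ne_zero
  rw [MZIndex.xi, funext (xiIntegrand_eq k n), integral_complex_ofReal, integral_const_mul,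
    (integral_pow_mul_polylog n hk).2, Nat.cast_succ, Complex.Gamma_nat_eq_factorial]
  push_cast
  field_simp

end MZShuffle

end

theorem proposition3p7 :
    (∃! Z : MZShuffle.H1 →ₗ[ℚ] Polynomial ℝ, MZShuffle.IsRegularization Z) ∧
      ∀ (k : MZIndex) (m : ℕ), k ≠ [] → 1 ≤ m →
        MeasureTheory.IntegrableOn (k.xiIntegrand (m : ℂ)) (Set.Ioi (0 : ℝ)) ∧
          k.xi (m : ℂ) =
            (((-1 : ℝ) ^ (m - 1) *
              MZShuffle.regMZV (k.plus ++ List.replicate (m - 1) (1 : ℕ+)) : ℝ) : ℂ) := by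
  refine ⟨⟨_, MZShuffle.isRegularization_expansion,
    fun Z hZ => hZ.unique MZShuffle.isRegularization_expansion⟩, fun k m hk hm => ?_⟩
  obtain ⟨n, rfl⟩ := Nat.exists_eq_add_of_le' hm
  refine ⟨MZShuffle.integrableOn_xiIntegrand hk n, ?_⟩
  -- The sign from the regularization cancels the sign in the statement.
  rw [MZShuffle.xi_natCast hk, Nat.add_sub_cancel, MZShuffle.regMZV_plus_append hk, ← mul_assoc,
    ← mul_pow, neg_one_mul, neg_neg, one_pow, one_mul]
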